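/- Let $n\ge 2$ and let $n^*$ be the set of finite words over the alphabet $\{0,1,\dots,n-1\}$, ordered by the prefix relation. Call a finite nonempty prefix-closed subset $\tau\subseteq n^*$ a tree if for every word $\alpha$ and all letters $i,j$ one has $\alpha i\in\tau$ if and only if $\alpha j\in\tau$; its leaves are its elements that are not a proper prefix of another element of $\tau$. A bijection $b$ from the leaves of a tree $\tau_0$ to the leaves of a tree $\tau_1$ induces the bijection $f_b(\alpha\gamma)=b(\alpha)\gamma$ ($\alpha$ a leaf of $\tau_0$, $\gamma\in n^*$) between two cofinite subsets of $n^*$. Bijections between cofinite subsets of $n^*$, considered equal when they agree on a cofinite set, form a group under composition (maps acting on the right), and the Higman--Thompson group $V_n$ is its subgroup consisting of the classes $[f_b]$. Theorem. For every integer $n\ge 2$, the group $V_n$ is generated by four involutions: there are four distinct elements of order $2$ in $V_n$ that generate $V_n$. -/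

import Mathlib

namespace HigmanThompson

open Filter

/-! ### Germs of bijections between cofinite subsets -/

/-- A bijection between two cofinite subsets `source` and `target` of `X`. -/
structure CofiniteBijection (X : Type*) where
  toPartialEquiv : PartialEquiv X X
  finite_compl_source : (toPartialEquiv.sourceᶜ).Finite
  finite_compl_target : (toPartialEquiv.targetᶜ).Finite

namespace CofiniteBijection

variable {X : Type*}

theorem eventually_source (f : CofiniteBijection X) :
    ∀ᶠ x in cofinite, x ∈ f.toPartialEquiv.source := f.finite_compl_source

theorem eventually_target (f : CofiniteBijection X) :
    ∀ᶠ x in cofinite, x ∈ f.toPartialEquiv.target := f.finite_compl_target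

theorem tendsto (f : CofiniteBijection X) :
    Tendsto f.toPartialEquiv cofinite cofinite := by
  intro s hs
  have h : (f.toPartialEquiv.symm '' sᶜ).Finite := Set.Finite.image _ hs
  refine (f.finite_compl_source.union h).subset ?_
  intro x hx
  by_cases hxs : x ∈ f.toPartialEquiv.source
  · exact Or.inr ⟨f.toPartialEquiv x, hx, f.toPartialEquiv.left_inv hxs⟩
  · exact Or.inl hxs

/-- The identity of `X`. -/
def one : CofiniteBijection X where
  toPartialEquiv := PartialEquiv.refl X
  finite_compl_source := by simp
  finite_compl_target := by simp

/-- The inverse bijection. -/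
def symm (f : CofiniteBijection X) : CofiniteBijection X where
  toPartialEquiv := f.toPartialEquiv.symm
  finite_compl_source := f.finite_compl_target
  finite_compl_target := f.finite_compl_source

/-- First `f`, then `g`, on the set of points where this makes sense. -/
def trans (f g : CofiniteBijection X) : CofiniteBijection X where
  toPartialEquiv := f.toPartialEquiv.trans g.toPartialEquiv
  finite_compl_source := by
    have h : ∀ᶠ x in cofinite, x ∈ (f.toPartialEquiv.trans g.toPartialEquiv).source := by
      filter_upwards [f.eventually_source, f.tendsto.eventually g.eventually_source] with x h1 h2
      rw [PartialEquiv.trans_source]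
      exact ⟨h1, h2⟩
    exact h
  finite_compl_target := by
    have h : ∀ᶠ x in cofinite, x ∈ (f.toPartialEquiv.trans g.toPartialEquiv).target := by
      filter_upwards [g.eventually_target,
        g.symm.tendsto.eventually f.eventually_target] with x h1 h2
      rw [PartialEquiv.trans_target]
      exact ⟨h1, h2⟩
    exact h

/-- Two bijections between cofinite sets are equivalent if they are equal on a cofinite set. -/
instance setoid (X : Type*) : Setoid (CofiniteBijection X) where
  r f g := ∃ S : Set X, Sᶜ.Finite ∧ S ⊆ f.toPartialEquiv.source ∧ S ⊆ g.toPartialEquiv.source ∧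
    ∀ x ∈ S, f.toPartialEquiv x = g.toPartialEquiv x
  iseqv :=
    { refl := fun f => ⟨_, f.finite_compl_source, subset_rfl, subset_rfl, fun _ _ => rfl⟩
      symm := fun ⟨S, h1, h2, h3, h4⟩ => ⟨S, h1, h3, h2, fun x hx => (h4 x hx).symm⟩
      trans := fun ⟨S, h1, h2, _, h4⟩ ⟨T, k1, _, k3, k4⟩ =>
        ⟨S ∩ T, by rw [Set.compl_inter]; exact h1.union k1,
          Set.inter_subset_left.trans h2, Set.inter_subset_right.trans k3,
          fun x hx => (h4 x hx.1).trans (k4 x hx.2)⟩ }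

theorem equiv_iff {f g : CofiniteBijection X} :
    f ≈ g ↔ ∀ᶠ x in cofinite, f.toPartialEquiv x = g.toPartialEquiv x := by
  constructor
  · rintro ⟨S, h1, -, -, h4⟩
    exact h1.subset fun x hx hxS => hx (h4 x hxS)
  · intro h
    refine ⟨{x | x ∈ f.toPartialEquiv.source ∧ x ∈ g.toPartialEquiv.source ∧
      f.toPartialEquiv x = g.toPartialEquiv x}, ?_, fun x hx => hx.1, fun x hx => hx.2.1,
      fun x hx => hx.2.2⟩
    exact f.eventually_source.and (g.eventually_source.and h)

theorem trans_equiv {f f' g g' : CofiniteBijection X} (hf : f ≈ f') (hg : g ≈ g') :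
    f.trans g ≈ f'.trans g' := by
  rw [equiv_iff] at hf hg ⊢
  filter_upwards [hf, f.tendsto.eventually hg] with x h1 h2
  change g.toPartialEquiv (f.toPartialEquiv x) = g'.toPartialEquiv (f'.toPartialEquiv x)
  rw [h2, h1]

theorem symm_equiv {f f' : CofiniteBijection X} (hf : f ≈ f') : f.symm ≈ f'.symm := by
  rw [equiv_iff] at hf ⊢
  filter_upwards [f.eventually_target, f.symm.tendsto.eventually hf,
    f.symm.tendsto.eventually f'.eventually_source] with y h1 h2 h3
  change f.toPartialEquiv.symm y = f'.toPartialEquiv.symm y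
  change f.toPartialEquiv (f.toPartialEquiv.symm y) =
    f'.toPartialEquiv (f.toPartialEquiv.symm y) at h2
  rw [f.toPartialEquiv.right_inv h1] at h2
  conv_rhs => rw [h2]
  exact (f'.toPartialEquiv.left_inv h3).symm

end CofiniteBijection

/-- The set of equivalence classes `[f]` of bijections `f` between cofinite subsets of `X`. -/
def CofiniteGerm (X : Type*) : Type _ := Quotient (CofiniteBijection.setoid X)

namespace CofiniteGerm

variable {X : Type*}

/-- The class `[f]`. -/
def mk (f : CofiniteBijection X) : CofiniteGerm X := Quotient.mk _ f

theorem mk_eq_mk {f g : CofiniteBijection X} :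
    mk f = mk g ↔ ∀ᶠ x in cofinite, f.toPartialEquiv x = g.toPartialEquiv x :=
  Quotient.eq.trans CofiniteBijection.equiv_iff

instance : One (CofiniteGerm X) := ⟨mk CofiniteBijection.one⟩

/-- Permutations act on the right: in `[f] * [g]` one first applies `f`, then `g`. -/
instance : Mul (CofiniteGerm X) :=
  ⟨Quotient.map₂ CofiniteBijection.trans fun _ _ hf _ _ hg => CofiniteBijection.trans_equiv hf hg⟩

instance : Inv (CofiniteGerm X) :=
  ⟨Quotient.map CofiniteBijection.symm fun _ _ hf => CofiniteBijection.symm_equiv hf⟩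

theorem mk_mul_mk (f g : CofiniteBijection X) : mk f * mk g = mk (f.trans g) := rfl

theorem inv_mk (f : CofiniteBijection X) : (mk f)⁻¹ = mk f.symm := rfl

theorem one_def : (1 : CofiniteGerm X) = mk CofiniteBijection.one := rfl

instance : Group (CofiniteGerm X) :=
  Group.ofLeftAxioms
    (by
      rintro ⟨f⟩ ⟨g⟩ ⟨h⟩
      exact mk_eq_mk.2 (Eventually.of_forall fun _ => rfl))
    (by
      rintro ⟨f⟩
      exact mk_eq_mk.2 (Eventually.of_forall fun _ => rfl))
    (by
      rintro ⟨f⟩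
      refine mk_eq_mk.2 ?_
      filter_upwards [f.eventually_target] with x hx
      exact f.toPartialEquiv.right_inv hx)

end CofiniteGerm

/-! ### Finite `n`-ary trees -/

/-- The set `n^*` of finite sequences of elements of `{0, …, n - 1}`. -/
abbrev Word (n : ℕ) : Type := List (Fin n)

/-- The finite nonempty rooted subtrees `τ` of `n^*` (i.e. prefix-closed subsets) such that
`α i ∈ τ` if and only if `α j ∈ τ`, for all words `α` and all letters `i`, `j`. -/
structure Tree (n : ℕ) where
  verts : Finset (Word n)
  nil_mem : [] ∈ verts
  mem_of_prefix : ∀ {α β : Word n}, α <+: β → β ∈ verts → α ∈ verts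
  sibling_mem : ∀ (α : Word n) (i j : Fin n), α ++ [i] ∈ verts → α ++ [j] ∈ verts

namespace Tree

variable {n : ℕ}

/-- The leaves of `τ`: the elements of `τ` that are not a proper prefix of an element of `τ`. -/
def leaves (τ : Tree n) : Set (Word n) :=
  {α | α ∈ τ.verts ∧ ∀ β ∈ τ.verts, α <+: β → β = α}

theorem leaf_unique (τ : Tree n) {α β w : Word n} (hα : α ∈ τ.leaves) (hβ : β ∈ τ.leaves)
    (h1 : α <+: w) (h2 : β <+: w) : α = β := by
  rcases List.prefix_or_prefix_of_prefix h1 h2 with h | h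
  · exact (hα.2 β hβ.1 h).symm
  · exact hβ.2 α hα.1 h

theorem exists_leaf_prefix (τ : Tree n) (w : Word n) (hw : w ∉ τ.verts) :
    ∃ α : τ.leaves, α.1 <+: w := by
  induction w using List.reverseRecOn with
  | nil => exact absurd τ.nil_mem hw
  | append_singleton u j ih =>
    by_cases hu : u ∈ τ.verts
    · by_cases hl : u ∈ τ.leaves
      · exact ⟨⟨u, hl⟩, List.prefix_append _ _⟩
      · exfalso
        have : ∃ β ∈ τ.verts, u <+: β ∧ β ≠ u := by
          by_contra! hcon
          exact hl ⟨hu, fun β hβ h => hcon β hβ h⟩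
        obtain ⟨β, hβ, ⟨t, rfl⟩, hne⟩ := this
        cases t with
        | nil => simp at hne
        | cons i t =>
          exact hw (τ.sibling_mem u i j (τ.mem_of_prefix ⟨t, by simp⟩ hβ))
    · obtain ⟨α, hα⟩ := ih hu
      exact ⟨α, hα.trans (List.prefix_append _ _)⟩

/-- The union of the sets `α n^*` over the leaves `α` of `τ`. -/
def cones (τ : Tree n) : Set (Word n) := {w | ∃ α : τ.leaves, α.1 <+: w}

theorem finite_compl_cones (τ : Tree n) : (τ.cones)ᶜ.Finite := by
  refine τ.verts.finite_toSet.subset fun w hw => ?_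
  by_contra h
  exact hw (τ.exists_leaf_prefix w h)

open Classical in
/-- The map that replaces the prefix `α`, a leaf of `τ₀`, by `b α`; see `leafMap_append`. Words
that have no leaf as a prefix are outside the domain of the map. -/
noncomputable def leafMap {τ₀ τ₁ : Tree n} (b : τ₀.leaves ≃ τ₁.leaves) (w : Word n) : Word n :=
  if h : ∃ α : τ₀.leaves, α.1 <+: w then
    (b h.choose).1 ++ w.drop h.choose.1.length
  else w

theorem leafMap_append {τ₀ τ₁ : Tree n} (b : τ₀.leaves ≃ τ₁.leaves) (α : τ₀.leaves)
    (γ : Word n) : leafMap b (α.1 ++ γ) = (b α).1 ++ γ := by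
  have h : ∃ β : τ₀.leaves, β.1 <+: α.1 ++ γ := ⟨α, List.prefix_append _ _⟩
  have hc : h.choose = α :=
    Subtype.ext (τ₀.leaf_unique h.choose.2 α.2 h.choose_spec (List.prefix_append _ _))
  rw [leafMap, dif_pos h, hc]
  simp

/-- For a bijection `b` from the leaves of `τ₀` to the leaves of `τ₁`, the bijection
`f_b (α γ) = b(α) γ` from the union of the `α n^*` to the union of the `b(α) n^*`. -/
noncomputable def leafBijection {τ₀ τ₁ : Tree n} (b : τ₀.leaves ≃ τ₁.leaves) :
    CofiniteBijection (Word n) where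
  toPartialEquiv :=
    { toFun := leafMap b
      invFun := leafMap b.symm
      source := τ₀.cones
      target := τ₁.cones
      map_source' := by
        rintro _ ⟨α, γ, rfl⟩
        rw [leafMap_append]
        exact ⟨b α, List.prefix_append _ _⟩
      map_target' := by
        rintro _ ⟨α, γ, rfl⟩
        rw [leafMap_append]
        exact ⟨b.symm α, List.prefix_append _ _⟩
      left_inv' := by
        rintro _ ⟨α, γ, rfl⟩
        rw [leafMap_append, leafMap_append, Equiv.symm_apply_apply]
      right_inv' := by
        rintro _ ⟨α, γ, rfl⟩
        rw [leafMap_append, leafMap_append, Equiv.apply_symm_apply] }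
  finite_compl_source := τ₀.finite_compl_cones
  finite_compl_target := τ₁.finite_compl_cones

end Tree

/-! ### The classes `[f_b]` form a subgroup -/

section Closure

variable {n : ℕ}

theorem eventually_forall_append {P : Word n → Prop} (h : ∀ᶠ w in cofinite, P w) :
    ∀ᶠ w in cofinite, ∀ γ, P (w ++ γ) := by
  have hfin : {w | ¬ P w}.Finite := h
  have : (⋃ w ∈ {w | ¬ P w}, {u : Word n | u <+: w}).Finite := by
    refine hfin.biUnion fun w _ => ?_
    refine (List.finite_toSet w.inits).subset fun u hu => ?_
    exact (List.mem_inits u w).2 hu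
  refine this.subset fun u hu => ?_
  obtain ⟨γ, hγ⟩ := not_forall.1 hu
  exact Set.mem_biUnion (x := u ++ γ) hγ (List.prefix_append _ _)

/-- An auxiliary description of the classes `[f_b]`, see `exists_leafBijection_iff`. -/
def EventuallyAppend (f : CofiniteBijection (Word n)) : Prop :=
  ∀ᶠ w in cofinite, ∀ γ, f.toPartialEquiv (w ++ γ) = f.toPartialEquiv w ++ γ

theorem EventuallyAppend.congr {f g : CofiniteBijection (Word n)} (hf : EventuallyAppend f)
    (h : ∀ᶠ x in cofinite, f.toPartialEquiv x = g.toPartialEquiv x) : EventuallyAppend g := by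
  filter_upwards [hf, eventually_forall_append h] with w h1 h2 γ
  have h3 := h2 []
  rw [List.append_nil] at h3
  rw [← h2, h1, h3]

theorem EventuallyAppend.trans {f g : CofiniteBijection (Word n)} (hf : EventuallyAppend f)
    (hg : EventuallyAppend g) : EventuallyAppend (f.trans g) := by
  filter_upwards [hf, f.tendsto.eventually hg] with w h1 h2 γ
  change g.toPartialEquiv (f.toPartialEquiv (w ++ γ)) =
    g.toPartialEquiv (f.toPartialEquiv w) ++ γ
  rw [h1, h2]

theorem EventuallyAppend.symm {f : CofiniteBijection (Word n)} (hf : EventuallyAppend f) :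
    EventuallyAppend f.symm := by
  filter_upwards [f.eventually_target, f.symm.tendsto.eventually hf,
    f.symm.tendsto.eventually (eventually_forall_append f.eventually_source)] with v h0 h1 h2 γ
  change f.toPartialEquiv.symm (v ++ γ) = f.toPartialEquiv.symm v ++ γ
  have h3 : f.toPartialEquiv (f.toPartialEquiv.symm v ++ γ) = v ++ γ := by
    refine (h1 γ).trans ?_
    change f.toPartialEquiv (f.toPartialEquiv.symm v) ++ γ = _
    rw [f.toPartialEquiv.right_inv h0]
  rw [← h3]
  exact f.toPartialEquiv.left_inv (h2 γ)

theorem eventuallyAppend_leafBijection {τ₀ τ₁ : Tree n} (b : τ₀.leaves ≃ τ₁.leaves) :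
    EventuallyAppend (Tree.leafBijection b) := by
  filter_upwards [(Tree.leafBijection b).eventually_source] with w hw γ
  obtain ⟨α, δ, rfl⟩ := hw
  change Tree.leafMap b _ = Tree.leafMap b _ ++ γ
  rw [List.append_assoc, Tree.leafMap_append, Tree.leafMap_append, List.append_assoc]

theorem exists_length_of_eventually {P : Word n → Prop} (h : ∀ᶠ w in cofinite, P w) :
    ∃ N, ∀ w : Word n, N ≤ w.length → P w := by
  have hfin : {w | ¬ P w}.Finite := h
  obtain ⟨N, hN⟩ := (hfin.image List.length).bddAbove
  refine ⟨N + 1, fun w hw => ?_⟩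
  by_contra hP
  have := hN ⟨w, hP, rfl⟩
  omega

theorem eventually_length (N : ℕ) : ∀ᶠ w : Word n in cofinite, N ≤ w.length := by
  refine (List.finite_length_lt (Fin n) N).subset fun w hw => ?_
  exact not_le.1 (show ¬ N ≤ w.length from hw)

/-- The full tree of words of length at most `N`. -/
noncomputable def fullTree (n N : ℕ) : Tree n where
  verts := (List.finite_length_le (Fin n) N).toFinset
  nil_mem := by simp
  mem_of_prefix := by
    intro α β h hβ
    simp only [Set.Finite.mem_toFinset, Set.mem_ofPred_eq] at hβ ⊢
    exact h.length_le.trans hβ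
  sibling_mem := by simp

theorem mem_leaves_fullTree (hn : n ≠ 0) (N : ℕ) (w : Word n) :
    w ∈ (fullTree n N).leaves ↔ w.length = N := by
  simp only [Tree.leaves, fullTree, Set.Finite.mem_toFinset, Set.mem_ofPred_eq]
  constructor
  · rintro ⟨h1, h2⟩
    by_contra hne
    have := h2 (w ++ [⟨0, Nat.pos_of_ne_zero hn⟩]) (by simp; omega) (List.prefix_append _ _)
    simp at this
  · rintro rfl
    exact ⟨le_rfl, fun β hβ h => (h.eq_of_length_le hβ).symm⟩

theorem exists_leafBijection_of_eventuallyAppend (f : CofiniteBijection (Word n))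
    (hf : EventuallyAppend f) :
    ∃ (τ₀ τ₁ : Tree n) (b : τ₀.leaves ≃ τ₁.leaves),
      CofiniteGerm.mk (Tree.leafBijection b) = CofiniteGerm.mk f := by
  rcases eq_or_ne n 0 with rfl | hn
  · refine ⟨fullTree 0 0, fullTree 0 0, Equiv.refl _, CofiniteGerm.mk_eq_mk.2 ?_⟩
    exact Eventually.of_forall fun x => Subsingleton.elim _ _
  have : Nonempty (Fin n) := ⟨⟨0, Nat.pos_of_ne_zero hn⟩⟩
  obtain ⟨N, hN⟩ := exists_length_of_eventually (hf.and f.eventually_source)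
  let F : Word n → Word n := ⇑f.toPartialEquiv
  have happ : ∀ w γ, N ≤ w.length → F (w ++ γ) = F w ++ γ := fun w γ h => (hN w h).1 γ
  have hinj : ∀ w w' : Word n, N ≤ w.length → N ≤ w'.length → F w = F w' → w = w' :=
    fun w w' h h' he => f.toPartialEquiv.injOn (hN w h).2 (hN w' h').2 he
  have hanti : ∀ w w' : Word n, w.length = N → w'.length = N → F w <+: F w' → w = w' := by
    rintro w w' h h' ⟨γ, hγ⟩
    have h2 := hinj (w ++ γ) w' (by simp; omega) h'.ge ((happ w γ h.ge).trans hγ)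
    exact List.IsPrefix.eq_of_length ⟨γ, h2⟩ (h.trans h'.symm)
  have hsurj : ∀ α : Word n, ∃ w γ δ : Word n, w.length = N ∧ F w ++ γ = α ++ δ := by
    intro α
    have hev : ∀ᶠ v in cofinite, ∃ u : Word n, N ≤ u.length ∧ F u = v := by
      filter_upwards [f.eventually_target,
        f.symm.tendsto.eventually (eventually_length N)] with v h1 h2
      exact ⟨_, h2, f.toPartialEquiv.right_inv h1⟩
    obtain ⟨M, hM⟩ := exists_length_of_eventually hev
    obtain ⟨u, hu, hFu⟩ := hM (α ++ List.replicate M (Classical.arbitrary (Fin n)))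
      (by simp)
    refine ⟨u.take N, u.drop N, List.replicate M (Classical.arbitrary (Fin n)),
      by simpa using hu, ?_⟩
    rw [← happ _ _ (by simpa using hu), List.take_append_drop, hFu]
  have hfin : {α : Word n | ∃ w : Word n, w.length = N ∧ α <+: F w}.Finite := by
    have : (⋃ w ∈ {w : Word n | w.length = N}, {α : Word n | α <+: F w}).Finite := by
      refine (List.finite_length_eq (Fin n) N).biUnion fun w _ => ?_
      exact (List.finite_toSet (F w).inits).subset fun u hu => (List.mem_inits u _).2 hu
    refine this.subset ?_
    rintro α ⟨w, hw, h⟩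
    exact Set.mem_biUnion (x := w) hw h
  let τ₁ : Tree n :=
    { verts := hfin.toFinset
      nil_mem := by
        rw [Set.Finite.mem_toFinset]
        exact ⟨List.replicate N (Classical.arbitrary (Fin n)), by simp, List.nil_prefix⟩
      mem_of_prefix := by
        intro α β h hβ
        rw [Set.Finite.mem_toFinset] at hβ ⊢
        obtain ⟨w, hw, hp⟩ := hβ
        exact ⟨w, hw, h.trans hp⟩
      sibling_mem := by
        intro α i j hi
        rw [Set.Finite.mem_toFinset] at hi ⊢
        obtain ⟨w, hw, hp⟩ := hi
        obtain ⟨w', γ, δ, hw', he⟩ := hsurj (α ++ [j])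
        have h1 : F w' <+: (α ++ [j]) ++ δ := ⟨γ, he⟩
        rcases List.prefix_or_prefix_of_prefix (List.prefix_append (α ++ [j]) δ) h1 with h | h
        · exact ⟨w', hw', h⟩
        · rcases List.prefix_concat_iff.1 h with h | h
          · exact ⟨w', hw', h ▸ List.prefix_rfl⟩
          · exfalso
            have h3 : F w' <+: F w := (h.trans (List.prefix_append α [i])).trans hp
            have h4 := hanti w' w hw' hw h3
            subst h4
            have h5 := (hp.trans h).length_le
            simp at h5 }
  have hleaf : ∀ v : Word n, v ∈ τ₁.leaves ↔ ∃ w : Word n, w.length = N ∧ F w = v := by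
    intro v
    simp only [Tree.leaves, τ₁, Set.Finite.mem_toFinset, Set.mem_ofPred_eq]
    constructor
    · rintro ⟨⟨w, hw, hp⟩, h⟩
      exact ⟨w, hw, h _ ⟨w, hw, List.prefix_rfl⟩ hp⟩
    · rintro ⟨w, hw, rfl⟩
      refine ⟨⟨w, hw, List.prefix_rfl⟩, ?_⟩
      rintro β ⟨w', hw', hp⟩ h
      have := hanti w w' hw hw' (h.trans hp)
      subst this
      exact hp.eq_of_length_le h.length_le
  let b : (fullTree n N).leaves ≃ τ₁.leaves := Equiv.ofBijective
    (fun α => ⟨F α.1, (hleaf _).2 ⟨α.1, (mem_leaves_fullTree hn N _).1 α.2, rfl⟩⟩) <| by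
      constructor
      · intro α β h
        exact Subtype.ext (hinj _ _ ((mem_leaves_fullTree hn N _).1 α.2).ge
          ((mem_leaves_fullTree hn N _).1 β.2).ge (Subtype.ext_iff.1 h))
      · rintro ⟨v, hv⟩
        obtain ⟨w, hw, rfl⟩ := (hleaf v).1 hv
        exact ⟨⟨w, (mem_leaves_fullTree hn N _).2 hw⟩, rfl⟩
  refine ⟨fullTree n N, τ₁, b, CofiniteGerm.mk_eq_mk.2 ?_⟩
  filter_upwards [(Tree.leafBijection b).eventually_source] with w hw
  obtain ⟨α, γ, rfl⟩ := hw
  change Tree.leafMap b _ = F _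
  rw [Tree.leafMap_append, happ _ _ ((mem_leaves_fullTree hn N _).1 α.2).ge]
  rfl

theorem exists_leafBijection_iff (f : CofiniteBijection (Word n)) :
    (∃ (τ₀ τ₁ : Tree n) (b : τ₀.leaves ≃ τ₁.leaves),
      CofiniteGerm.mk (Tree.leafBijection b) = CofiniteGerm.mk f) ↔ EventuallyAppend f := by
  refine ⟨?_, exists_leafBijection_of_eventuallyAppend f⟩
  rintro ⟨τ₀, τ₁, b, h⟩
  exact (eventuallyAppend_leafBijection b).congr (CofiniteGerm.mk_eq_mk.1 h)

end Closure

/-- The Higman–Thompson group `V_n`: the group of the classes `[f_b]`, where `b` is a bijection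
from the leaves of a tree `τ₀` to the leaves of a tree `τ₁`. -/
def V (n : ℕ) : Subgroup (CofiniteGerm (Word n)) where
  carrier := {g | ∃ (τ₀ τ₁ : Tree n) (b : τ₀.leaves ≃ τ₁.leaves),
    CofiniteGerm.mk (Tree.leafBijection b) = g}
  one_mem' := by
    refine (exists_leafBijection_iff _).2 ?_
    exact Eventually.of_forall fun _ _ => rfl
  mul_mem' := by
    rintro ⟨f⟩ ⟨g⟩ hf hg
    exact (exists_leafBijection_iff _).2
      (((exists_leafBijection_iff f).1 hf).trans ((exists_leafBijection_iff g).1 hg))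
  inv_mem' := by
    rintro ⟨f⟩ hf
    exact (exists_leafBijection_iff _).2 ((exists_leafBijection_iff f).1 hf).symm

end HigmanThompson

/-!
The elements of `V_n` act by replacing prefixes: `MapsCone g α β` says that `g` maps the cone
`α n^*` onto the cone `β n^*` by `αγ ↦ βγ`, up to finitely many words. An element is determined by
such data (`eq_of_mapsCone`), and for incomparable `α`, `β` the group contains the involution
`coneSwap` that interchanges the two cones. Conjugating a cone swap by an element that maps `α` to
`α'` and `β` to `β'` gives the swap of `α'` and `β'` (`conj_coneSwap`).

The cone swaps generate `V_n` (`V_le_of_coneSwap_mem`). An element of `V_n` maps a complete prefix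
code bijectively to another one, and each code with more than one word contains a caret, that is,
all the words `α i` for some `α`. Multiplying by cone swaps permutes the range code, so a caret of
the domain code may be assumed to be mapped to a caret of the range code in order; contracting both
carets gives smaller codes, and the code `{[]}` belongs to the identity.

The four generators are three permutations of the `n²` words of length two and the swap of the cones
of `0` and `10`. After the words are numbered by `ZMod (n²)`, the three permutations are the
reflections `x ↦ -x` and `x ↦ 1 - x`, whose product is an `n²`-cycle, and a transposition of two
neighbours; they generate the full symmetric group (`closure_reflections_swap`). Together with the
fourth generator this yields all swaps of words of length at most two
(`coneSwap_mem_of_length_le_two`), and conjugating by these reduces every other cone swap to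
shorter words (`coneSwap_mem`).
-/

namespace HigmanThompson

open Filter

variable {n : ℕ}

/-! ### Prefix replacement by germs -/

/-- The germ `g` sends the cone `α n^*` to the cone `β n^*` by replacing the prefix `α` by `β`.
As `g` is only a germ, finitely many words of the cone are disregarded. -/
def MapsCone (g : CofiniteGerm (Word n)) (α β : Word n) : Prop :=
  ∃ f, CofiniteGerm.mk f = g ∧ ∀ᶠ γ in cofinite, f.toPartialEquiv (α ++ γ) = β ++ γ

theorem tendsto_append_cofinite (α : Word n) :
    Tendsto (fun γ : Word n => α ++ γ) cofinite cofinite :=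
  (List.append_right_injective α).tendsto_cofinite

theorem mapsCone_mk {f : CofiniteBijection (Word n)} {α β : Word n} :
    MapsCone (CofiniteGerm.mk f) α β ↔
      ∀ᶠ γ in cofinite, f.toPartialEquiv (α ++ γ) = β ++ γ := by
  refine ⟨?_, fun h => ⟨f, rfl, h⟩⟩
  rintro ⟨f', hf', h⟩
  filter_upwards [h, (tendsto_append_cofinite α).eventually (CofiniteGerm.mk_eq_mk.1 hf')]
    with γ h1 h2
  rw [← h2, h1]

namespace MapsCone

variable {g h : CofiniteGerm (Word n)} {α β δ : Word n}

theorem one (α : Word n) : MapsCone 1 α α :=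
  ⟨_, rfl, Eventually.of_forall fun _ => rfl⟩

theorem mul (hg : MapsCone g α β) (hh : MapsCone h β δ) : MapsCone (g * h) α δ := by
  obtain ⟨f, rfl, hf⟩ := hg
  obtain ⟨f', rfl, hf'⟩ := hh
  rw [CofiniteGerm.mk_mul_mk, mapsCone_mk]
  filter_upwards [hf, hf'] with γ h1 h2
  change f'.toPartialEquiv (f.toPartialEquiv _) = _
  rw [h1, h2]

theorem inv (hg : MapsCone g α β) : MapsCone g⁻¹ β α := by
  obtain ⟨f, rfl, hf⟩ := hg
  rw [CofiniteGerm.inv_mk, mapsCone_mk]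
  filter_upwards [hf, (tendsto_append_cofinite α).eventually f.eventually_source] with γ h1 h2
  change f.toPartialEquiv.symm _ = _
  rw [← h1, f.toPartialEquiv.left_inv h2]

theorem append (hg : MapsCone g α β) (γ : Word n) : MapsCone g (α ++ γ) (β ++ γ) := by
  obtain ⟨f, rfl, hf⟩ := hg
  rw [mapsCone_mk]
  filter_upwards [(tendsto_append_cofinite γ).eventually hf] with δ h1
  rw [List.append_assoc, h1, List.append_assoc]

theorem of_children (h : ∀ i, MapsCone g (α ++ [i]) (β ++ [i])) : MapsCone g α β := by
  obtain ⟨f, rfl⟩ := Quotient.exists_rep g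
  refine mapsCone_mk.2 ?_
  obtain ⟨M, hM⟩ := exists_length_of_eventually (eventually_all.2 fun i => mapsCone_mk.1 (h i))
  filter_upwards [eventually_length (M + 1)] with γ hγ
  cases γ with
  | nil => simp at hγ
  | cons i γ => simpa using hM γ (by simpa using hγ) i

theorem unique [NeZero n] (h1 : MapsCone g α β) (h2 : MapsCone g α δ) : β = δ := by
  obtain ⟨f, rfl, hf⟩ := h1
  obtain ⟨γ, h3, h4⟩ := (hf.and (mapsCone_mk.1 h2)).exists
  exact List.append_left_injective γ (h3.symm.trans h4)

theorem prefix_of_prefix [NeZero n] {α' β' : Word n} (h1 : MapsCone g α β)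
    (h2 : MapsCone g α' β') (h : β <+: β') : α <+: α' := by
  obtain ⟨γ, rfl⟩ := h
  exact ⟨γ, ((h1.append γ).inv).unique h2.inv⟩

end MapsCone

/-- A germ is determined by the prefix replacements that it makes at any level of `n^*`. -/
theorem eq_of_mapsCone {g h : CofiniteGerm (Word n)} (N : ℕ)
    (hgh : ∀ w : Word n, w.length = N → ∃ β, MapsCone g w β ∧ MapsCone h w β) : g = h := by
  obtain ⟨f, rfl⟩ := Quotient.exists_rep g
  obtain ⟨f', rfl⟩ := Quotient.exists_rep h
  refine CofiniteGerm.mk_eq_mk.2 ?_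
  have key : ∀ᶠ γ in cofinite, ∀ w ∈ {w : Word n | w.length = N},
      f.toPartialEquiv (w ++ γ) = f'.toPartialEquiv (w ++ γ) := by
    refine (eventually_all_finite (List.finite_length_eq (Fin n) N)).2 fun w hw => ?_
    obtain ⟨β, h1, h2⟩ := hgh w hw
    filter_upwards [mapsCone_mk.1 h1, mapsCone_mk.1 h2] with γ h3 h4
    rw [h3, h4]
  obtain ⟨M, hM⟩ := exists_length_of_eventually key
  filter_upwards [eventually_length (N + M)] with v hv
  have := hM (v.drop N) (by simp; omega) (v.take N) (by simp; omega)
  rwa [List.take_append_drop] at this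

/-- An element of `V_n` replaces prefixes on the cones of all sufficiently long words. -/
theorem exists_mapsCone_of_mem_V {g : CofiniteGerm (Word n)} (hg : g ∈ V n) :
    ∃ N, ∀ w : Word n, N ≤ w.length → ∃ β, MapsCone g w β := by
  obtain ⟨f, rfl⟩ := Quotient.exists_rep g
  obtain ⟨N, hN⟩ := exists_length_of_eventually ((exists_leafBijection_iff f).1 hg)
  exact ⟨N, fun w hw => ⟨_, mapsCone_mk.2 (Eventually.of_forall (hN w hw))⟩⟩

/-! ### Germs of permutations of `n^*` -/

/-- A permutation of `X`, as a bijection between cofinite sets. -/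
def CofiniteBijection.ofPerm {X : Type*} (e : Equiv.Perm X) : CofiniteBijection X where
  toPartialEquiv := e.toPartialEquiv
  finite_compl_source := by simp
  finite_compl_target := by simp

/-- The class of the inverse of a permutation. The inverse makes this a homomorphism, since
permutations multiply from right to left and germs from left to right. -/
def permGerm {X : Type*} : Equiv.Perm X →* CofiniteGerm X where
  toFun e := CofiniteGerm.mk (.ofPerm e⁻¹)
  map_one' := rfl
  map_mul' e e' := by
    rw [CofiniteGerm.mk_mul_mk, mul_inv_rev]
    exact CofiniteGerm.mk_eq_mk.2 (Eventually.of_forall fun _ => rfl)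

/-- The hypothesis goes from `β` to `α` because `permGerm e` is the class of the inverse of `e`. -/
theorem mapsCone_permGerm {e : Equiv.Perm (Word n)} {α β : Word n}
    (h : ∀ γ, γ ≠ [] → e (β ++ γ) = α ++ γ) : MapsCone (permGerm e) α β := by
  refine mapsCone_mk.2 ?_
  filter_upwards [eventually_length 1] with γ hγ
  change e⁻¹ _ = _
  rw [Equiv.Perm.inv_eq_iff_eq, h γ (by rintro rfl; simp at hγ)]

theorem permGerm_mem_V {e : Equiv.Perm (Word n)} (N : ℕ)
    (h : ∀ w γ : Word n, N ≤ w.length → e (w ++ γ) = e w ++ γ) : permGerm e ∈ V n := by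
  have : permGerm e⁻¹ ∈ V n := by
    refine (exists_leafBijection_iff _).2 ?_
    filter_upwards [eventually_length N] with w hw γ
    exact h w γ hw
  rw [map_inv] at this
  exact inv_mem_iff.1 this

/-! ### Interchanging two cones -/

/-- The words `α` and `β` are incomparable for the prefix relation. -/
def Incomparable (α β : Word n) : Prop := ¬ α <+: β ∧ ¬ β <+: α

namespace Incomparable

variable {α β w : Word n}

theorem symm (h : Incomparable α β) : Incomparable β α := ⟨h.2, h.1⟩

theorem not_prefix_right (h : Incomparable α β) (h1 : α <+: w) : ¬ β <+: w := fun h2 =>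
  (List.prefix_or_prefix_of_prefix h1 h2).elim h.1 h.2

theorem of_length_le (h : α.length ≤ w.length) (h1 : ¬ α <+: w) : Incomparable α w :=
  ⟨h1, fun h2 => h1 (h2.eq_of_length_le h ▸ List.prefix_rfl)⟩

end Incomparable

theorem MapsCone.incomparable [NeZero n] {g : CofiniteGerm (Word n)} {α β α' β' : Word n}
    (h1 : MapsCone g α α') (h2 : MapsCone g β β') (h : Incomparable α β) :
    Incomparable α' β' :=
  ⟨fun h3 => h.1 (h1.prefix_of_prefix h2 h3), fun h3 => h.2 (h2.prefix_of_prefix h1 h3)⟩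

open Classical in
/-- The map that replaces a prefix `α` by `β` and a prefix `β` by `α`. -/
noncomputable def swapPrefix (α β w : Word n) : Word n :=
  if α <+: w then β ++ w.drop α.length
  else if β <+: w then α ++ w.drop β.length
  else w

theorem swapPrefix_append_left (α β γ : Word n) : swapPrefix α β (α ++ γ) = β ++ γ := by
  simp [swapPrefix]

theorem swapPrefix_append_right {α β : Word n} (h : Incomparable α β) (γ : Word n) :
    swapPrefix α β (β ++ γ) = α ++ γ := by
  rw [swapPrefix, if_neg (h.symm.not_prefix_right (List.prefix_append _ _)),
    if_pos (List.prefix_append _ _), List.drop_left]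

theorem swapPrefix_of_not_prefix {α β w : Word n} (h1 : ¬ α <+: w) (h2 : ¬ β <+: w) :
    swapPrefix α β w = w := by
  rw [swapPrefix, if_neg h1, if_neg h2]

theorem swapPrefix_involutive {α β : Word n} (h : Incomparable α β) :
    Function.Involutive (swapPrefix α β) := by
  intro w
  by_cases h1 : α <+: w
  · obtain ⟨γ, rfl⟩ := h1
    rw [swapPrefix_append_left, swapPrefix_append_right h]
  by_cases h2 : β <+: w
  · obtain ⟨γ, rfl⟩ := h2
    rw [swapPrefix_append_right h, swapPrefix_append_left]
  rw [swapPrefix_of_not_prefix h1 h2, swapPrefix_of_not_prefix h1 h2]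

/-- The element of `V_n` that interchanges the cones of two incomparable words `α` and `β` and
fixes all other words. -/
noncomputable def coneSwap {α β : Word n} (h : Incomparable α β) : CofiniteGerm (Word n) :=
  permGerm (swapPrefix_involutive h).toPerm

section ConeSwap

variable {α β : Word n} (h : Incomparable α β)

theorem mapsCone_coneSwap_left : MapsCone (coneSwap h) α β :=
  mapsCone_permGerm fun γ _ => swapPrefix_append_right h γ

theorem mapsCone_coneSwap_right : MapsCone (coneSwap h) β α :=
  mapsCone_permGerm fun γ _ => swapPrefix_append_left α β γ

theorem mapsCone_coneSwap_of_incomparable {w : Word n} (h1 : Incomparable α w)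
    (h2 : Incomparable β w) : MapsCone (coneSwap h) w w :=
  mapsCone_permGerm fun _ _ => swapPrefix_of_not_prefix
    (h1.symm.not_prefix_right (List.prefix_append _ _))
    (h2.symm.not_prefix_right (List.prefix_append _ _))

theorem coneSwap_mul_self : coneSwap h * coneSwap h = 1 := by
  rw [coneSwap, ← map_mul, ← map_one permGerm]
  congr 1
  ext1 w
  exact swapPrefix_involutive h w

theorem coneSwap_mem_V : coneSwap h ∈ V n := by
  refine permGerm_mem_V (α.length + β.length) fun w γ hw => ?_
  change swapPrefix α β _ = swapPrefix α β _ ++ _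
  by_cases h1 : α <+: w
  · obtain ⟨δ, rfl⟩ := h1
    rw [List.append_assoc, swapPrefix_append_left, swapPrefix_append_left, List.append_assoc]
  by_cases h2 : β <+: w
  · obtain ⟨δ, rfl⟩ := h2
    rw [List.append_assoc, swapPrefix_append_right h, swapPrefix_append_right h,
      List.append_assoc]
  have h3 := Incomparable.of_length_le (by omega) h1
  have h4 := Incomparable.of_length_le (by omega) h2
  rw [swapPrefix_of_not_prefix h1 h2, swapPrefix_of_not_prefix
    (h3.symm.not_prefix_right (List.prefix_append _ _))
    (h4.symm.not_prefix_right (List.prefix_append _ _))]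

/-- A cone swap is determined by its action on the two cones and on all small cones disjoint from
them. -/
theorem eq_coneSwap {g : CofiniteGerm (Word n)} (N : ℕ) (h1 : MapsCone g α β)
    (h2 : MapsCone g β α) (h3 : ∀ w : Word n, N ≤ w.length → Incomparable α w →
      Incomparable β w → MapsCone g w w) : g = coneSwap h := by
  refine eq_of_mapsCone (N + α.length + β.length) fun w hw => ?_
  by_cases hα : α <+: w
  · obtain ⟨γ, rfl⟩ := hα
    exact ⟨_, h1.append γ, (mapsCone_coneSwap_left h).append γ⟩
  by_cases hβ : β <+: w
  · obtain ⟨γ, rfl⟩ := hβ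
    exact ⟨_, h2.append γ, (mapsCone_coneSwap_right h).append γ⟩
  have hα' := Incomparable.of_length_le (by omega) hα
  have hβ' := Incomparable.of_length_le (by omega) hβ
  exact ⟨w, h3 w (by omega) hα' hβ', mapsCone_coneSwap_of_incomparable h hα' hβ'⟩

theorem coneSwap_symm : coneSwap h.symm = coneSwap h :=
  eq_coneSwap h 0 (mapsCone_coneSwap_right _) (mapsCone_coneSwap_left _)
    fun _ _ h1 h2 => mapsCone_coneSwap_of_incomparable _ h2 h1

theorem conj_coneSwap [NeZero n] {α' β' : Word n} {g : CofiniteGerm (Word n)} (hg : g ∈ V n)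
    (h1 : MapsCone g α α') (h2 : MapsCone g β β') (h' : Incomparable α' β') :
    g⁻¹ * coneSwap h * g = coneSwap h' := by
  obtain ⟨N, hN⟩ := exists_mapsCone_of_mem_V (inv_mem hg)
  refine eq_coneSwap h' N ((h1.inv.mul (mapsCone_coneSwap_left h)).mul h2)
    ((h2.inv.mul (mapsCone_coneSwap_right h)).mul h1) fun w hw hα hβ => ?_
  obtain ⟨u, hu⟩ := hN w hw
  have hu' : MapsCone g u w := by simpa using hu.inv
  exact (hu.mul (mapsCone_coneSwap_of_incomparable h (h1.inv.incomparable hu hα)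
    (h2.inv.incomparable hu hβ))).mul hu'

end ConeSwap

/-! ### Cone swaps generate `V_n` -/

/-- A finite set of words is a complete prefix code: its elements are pairwise incomparable, and
every word is comparable with one of them. These are the sets of leaves of the trees. -/
structure IsCompleteCode (A : Finset (Word n)) : Prop where
  eq_of_prefix : ∀ a ∈ A, ∀ b ∈ A, a <+: b → a = b
  exists_comparable : ∀ w : Word n, ∃ a ∈ A, a <+: w ∨ w <+: a

namespace IsCompleteCode

variable {A : Finset (Word n)}

/-- The siblings of a word of maximal length in a complete code all belong to the code. -/
theorem exists_caret (hA : IsCompleteCode A) (h : [] ∉ A) :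
    ∃ α : Word n, ∀ i, α ++ [i] ∈ A := by
  obtain ⟨a₀, ha₀, -⟩ := hA.exists_comparable []
  obtain ⟨a, ha, hmax⟩ := A.exists_max_image List.length ⟨a₀, ha₀⟩
  rcases List.eq_nil_or_concat' a with rfl | ⟨α, j, rfl⟩
  · exact absurd ha h
  refine ⟨α, fun i => ?_⟩
  obtain ⟨b, hb, hb' | hb'⟩ := hA.exists_comparable (α ++ [i])
  · rcases List.prefix_concat_iff.1 hb' with rfl | hb'
    · exact hb
    · have := hA.eq_of_prefix b hb _ ha (hb'.trans (List.prefix_append _ _))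
      subst this
      simpa using hb'.length_le
  · have := hmax b hb
    rw [hb'.eq_of_length_le (by simpa using this)]
    exact hb

theorem card_le_one_iff (hn : 2 ≤ n) (hA : IsCompleteCode A) : A.card ≤ 1 ↔ [] ∈ A := by
  rw [Finset.card_le_one]
  constructor
  · intro h
    by_contra h0
    obtain ⟨α, hα⟩ := hA.exists_caret h0
    have := h _ (hα ⟨0, by omega⟩) _ (hα ⟨1, by omega⟩)
    simp at this
  · intro h0 a ha b hb
    rw [← hA.eq_of_prefix _ h0 a ha List.nil_prefix, ← hA.eq_of_prefix _ h0 b hb List.nil_prefix]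

/-- Replacing the `n` words `α i` of a complete code by `α` gives a complete code. -/
theorem contract (hn : 2 ≤ n) (hA : IsCompleteCode A) {α : Word n} (hα : ∀ i, α ++ [i] ∈ A) :
    ∃ B : Finset (Word n), IsCompleteCode B ∧ B.card < A.card ∧
      ∀ b ∈ B, b = α ∨ b ∈ A := by
  classical
  let C : Finset (Word n) := Finset.univ.image fun i => α ++ [i]
  have hC : ∀ b, b ∈ C ↔ ∃ i, α ++ [i] = b := by simp [C]
  have hCA : C ⊆ A := fun b hb => by
    obtain ⟨i, rfl⟩ := (hC b).1 hb
    exact hα i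
  have hcard : C.card = n := by
    rw [Finset.card_image_of_injective _ fun i j h => by simpa using h, Finset.card_univ,
      Fintype.card_fin]
  have key : ∀ b ∈ A \ C, ¬ b <+: α ∧ ¬ α <+: b := by
    intro b hb
    rw [Finset.mem_sdiff, hC] at hb
    have h1 : ∀ i, ¬ b <+: α ++ [i] := fun i h =>
      hb.2 ⟨i, (hA.eq_of_prefix b hb.1 _ (hα i) h).symm⟩
    have h2 : ¬ b <+: α := fun h => h1 ⟨0, by omega⟩ (h.trans (List.prefix_append _ _))
    refine ⟨h2, ?_⟩
    rintro ⟨t, rfl⟩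
    cases t with
    | nil => simp at h2
    | cons i t => exact hb.2 ⟨i, hA.eq_of_prefix _ (hα i) _ hb.1 ⟨t, by simp⟩⟩
  refine ⟨insert α (A \ C), ⟨?_, ?_⟩, ?_, ?_⟩
  · intro a ha b hb hab
    rcases Finset.mem_insert.1 ha with rfl | ha' <;> rcases Finset.mem_insert.1 hb with rfl | hb'
    · rfl
    · exact absurd hab (key b hb').2
    · exact absurd hab (key a ha').1
    · exact hA.eq_of_prefix a (Finset.mem_sdiff.1 ha').1 b (Finset.mem_sdiff.1 hb').1 hab
  · intro w
    obtain ⟨a, ha, h⟩ := hA.exists_comparable w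
    by_cases haC : a ∈ C
    · obtain ⟨i, rfl⟩ := (hC a).1 haC
      refine ⟨α, Finset.mem_insert_self _ _, ?_⟩
      rcases h with h | h
      · exact .inl ((List.prefix_append _ _).trans h)
      · exact (List.prefix_or_prefix_of_prefix (List.prefix_append _ _) h)
    · exact ⟨a, Finset.mem_insert_of_mem (Finset.mem_sdiff.2 ⟨ha, haC⟩), h⟩
  · have h1 := Finset.card_insert_le α (A \ C)
    have h2 := Finset.card_sdiff_add_card_eq_card hCA
    omega
  · intro b hb
    exact (Finset.mem_insert.1 hb).imp_right fun hb => (Finset.mem_sdiff.1 hb).1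

end IsCompleteCode

theorem isCompleteCode_length [NeZero n] (N : ℕ) :
    IsCompleteCode (List.finite_length_eq (Fin n) N).toFinset where
  eq_of_prefix a ha b hb h := by
    simp only [Set.Finite.mem_toFinset, Set.mem_ofPred_eq] at ha hb
    exact h.eq_of_length (ha.trans hb.symm)
  exists_comparable w := by
    simp only [Set.Finite.mem_toFinset, Set.mem_ofPred_eq]
    rcases le_total N w.length with h | h
    · exact ⟨w.take N, by simpa using h, .inl (List.take_prefix _ _)⟩
    · exact ⟨w ++ List.replicate (N - w.length) 0, by simp [h],
        .inr (List.prefix_append _ _)⟩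

section Generation

variable [NeZero n] {A : Finset (Word n)} {F : Word n → Word n} {g : CofiniteGerm (Word n)}

theorem injOn_of_mapsCone (hF : ∀ a ∈ A, MapsCone g a (F a)) : Set.InjOn F A := by
  intro a ha b hb h
  have h1 := (hF b hb).inv
  rw [← h] at h1
  exact (hF a ha).inv.unique h1

/-- The images of the words of a complete code under an element of `V_n` form a complete code:
incomparable words go to incomparable words, and the element is surjective up to finitely many
words. -/
theorem IsCompleteCode.image [DecidableEq (Word n)] (hg : g ∈ V n) (hA : IsCompleteCode A)
    (hF : ∀ a ∈ A, MapsCone g a (F a)) : IsCompleteCode (A.image F) where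
  eq_of_prefix := by
    simp only [Finset.mem_image, forall_exists_index, and_imp, forall_apply_eq_imp_iff₂]
    intro a ha b hb h
    rw [hA.eq_of_prefix a ha b hb ((hF a ha).prefix_of_prefix (hF b hb) h)]
  exists_comparable w := by
    obtain ⟨N, hN⟩ := exists_mapsCone_of_mem_V (inv_mem hg)
    obtain ⟨u, hu⟩ := hN (w ++ List.replicate N 0) (by simp)
    have hu' : MapsCone g u (w ++ List.replicate N 0) := by simpa using hu.inv
    obtain ⟨a, ha, ⟨γ, rfl⟩ | ⟨γ, rfl⟩⟩ := hA.exists_comparable u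
    · refine ⟨F a, Finset.mem_image_of_mem F ha, ?_⟩
      have h := hu'.unique ((hF a ha).append γ)
      exact List.prefix_or_prefix_of_prefix (List.prefix_append _ γ)
        (h ▸ List.prefix_append w (List.replicate N 0))
    · refine ⟨F (u ++ γ), Finset.mem_image_of_mem F ha, .inr ?_⟩
      rw [(hF _ ha).unique (hu'.append γ), List.append_assoc]
      exact List.prefix_append _ _

variable {G : Subgroup (CofiniteGerm (Word n))}

/-- A subgroup that contains all cone swaps permutes the cones of an image of a code
arbitrarily. -/
theorem exists_mem_forall_mapsCone_perm
    (hswap : ∀ {α β : Word n} (h : Incomparable α β), coneSwap h ∈ G)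
    (hA : IsCompleteCode A) (hF : ∀ a ∈ A, MapsCone g a (F a)) (π : Equiv.Perm A) :
    ∃ h ∈ G, ∀ a : A, MapsCone h (F a) (F (π a)) := by
  classical
  induction π using Equiv.Perm.swap_induction_on with
  | one => exact ⟨1, one_mem _, fun a => MapsCone.one _⟩
  | swap_mul π x y hxy ih =>
    obtain ⟨h, hG, hh⟩ := ih
    have hinc : ∀ a b : A, a ≠ b → Incomparable (F a) (F b) := fun a b hab =>
      (hF a a.2).incomparable (hF b b.2)
        ⟨fun h => hab (Subtype.ext (hA.eq_of_prefix _ a.2 _ b.2 h)),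
          fun h => hab (Subtype.ext (hA.eq_of_prefix _ b.2 _ a.2 h).symm)⟩
    refine ⟨h * coneSwap (hinc x y hxy), mul_mem hG (hswap _), fun a => (hh a).mul ?_⟩
    rw [Equiv.Perm.mul_apply]
    by_cases hx : π a = x
    · rw [hx, Equiv.swap_apply_left]
      exact mapsCone_coneSwap_left _
    by_cases hy : π a = y
    · rw [hy, Equiv.swap_apply_right]
      exact mapsCone_coneSwap_right _
    rw [Equiv.swap_apply_of_ne_of_ne hx hy]
    exact mapsCone_coneSwap_of_incomparable _ (hinc _ _ (Ne.symm hx)) (hinc _ _ (Ne.symm hy))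

/-- Up to cone swaps, an element of `V_n` maps a caret of its domain code to a caret of its range
code; contracting both carets gives a smaller code. -/
theorem mem_of_isCompleteCode (hn : 2 ≤ n) (hGV : G ≤ V n)
    (hswap : ∀ {α β : Word n} (h : Incomparable α β), coneSwap h ∈ G)
    (hg : g ∈ V n) (hA : IsCompleteCode A) (hF : ∀ a ∈ A, MapsCone g a (F a)) : g ∈ G := by
  classical
  induction hk : A.card using Nat.strong_induction_on generalizing A F g with
  | _ k ih =>
  have himg := hA.image hg hF
  have hcard := Finset.card_image_of_injOn (injOn_of_mapsCone hF)
  by_cases h0 : [] ∈ A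
  · have h1 : [] ∈ A.image F := by
      rwa [← himg.card_le_one_iff hn, hcard, hA.card_le_one_iff hn]
    obtain ⟨a, ha, hFa⟩ := Finset.mem_image.1 h1
    obtain rfl := hA.eq_of_prefix _ h0 a ha List.nil_prefix
    have hg1 : g = 1 := eq_of_mapsCone 0 fun w hw => by
      obtain rfl := List.length_eq_zero_iff.1 hw
      exact ⟨[], by simpa [hFa] using hF [] ha, MapsCone.one _⟩
    exact hg1 ▸ one_mem _
  · have h1 : [] ∉ A.image F := by
      rwa [← himg.card_le_one_iff hn, hcard, hA.card_le_one_iff hn]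
    obtain ⟨α, hα⟩ := hA.exists_caret h0
    obtain ⟨β, hβ⟩ := himg.exists_caret h1
    choose c hcA hc using fun i => Finset.mem_image.1 (hβ i)
    let x : Fin n ↪ A := ⟨fun i => ⟨α ++ [i], hα i⟩, fun i j h => by simpa using h⟩
    let y : Fin n ↪ A := ⟨fun i => ⟨c i, hcA i⟩, fun i j h => by
      have h := congrArg F (Subtype.ext_iff.1 h)
      simpa [hc] using h⟩
    obtain ⟨π, hπ⟩ := (Equiv.Perm.isMultiplyPretransitive A n).exists_smul_eq x y
    obtain ⟨h, hG, hh⟩ := exists_mem_forall_mapsCone_perm hswap hA hF π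
    have hπ' : ∀ i, F (π ⟨α ++ [i], hα i⟩) = β ++ [i] := fun i => by
      rw [← hc i]
      exact congrArg (fun z : A => F z) (DFunLike.congr_fun hπ i)
    obtain ⟨B, hB, hBcard, hBA⟩ := hA.contract hn hα
    have hgh : ∀ a (ha : a ∈ A), MapsCone (g * h) a (F (π ⟨a, ha⟩)) := fun a ha =>
      (hF a ha).mul (hh ⟨a, ha⟩)
    have hghα : MapsCone (g * h) α β :=
      .of_children fun i => hπ' i ▸ hgh _ (hα i)
    have hex : ∀ b ∈ B, ∃ b', MapsCone (g * h) b b' := fun b hb => by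
      rcases hBA b hb with rfl | hb
      · exact ⟨_, hghα⟩
      · exact ⟨_, hgh b hb⟩
    choose! F' hF' using hex
    have := ih B.card (hk ▸ hBcard) (mul_mem hg (hGV hG)) hB hF' rfl
    exact (Subgroup.mul_mem_cancel_right G hG).1 this

theorem V_le_of_coneSwap_mem (hn : 2 ≤ n) (hGV : G ≤ V n)
    (hswap : ∀ {α β : Word n} (h : Incomparable α β), coneSwap h ∈ G) : V n ≤ G := by
  intro g hg
  obtain ⟨N, hN⟩ := exists_mapsCone_of_mem_V hg
  choose! F hF using hN
  refine mem_of_isCompleteCode hn hGV hswap hg (isCompleteCode_length N) fun a ha => hF a ?_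
  rw [Set.Finite.mem_toFinset] at ha
  exact ha.ge

end Generation

/-! ### Permutations of the words of length two -/

/-- The map of `n^*` that applies `p` to the first two letters of a word; the words of length less
than two are fixed. -/
def pairMap (p : Fin n × Fin n → Fin n × Fin n) : Word n → Word n
  | a :: b :: w => (p (a, b)).1 :: (p (a, b)).2 :: w
  | w => w

theorem pairMap_comp (p q : Fin n × Fin n → Fin n × Fin n) (w : Word n) :
    pairMap (p ∘ q) w = pairMap p (pairMap q w) := by
  rcases w with _ | ⟨a, _ | ⟨b, w⟩⟩ <;> rfl

theorem pairMap_id (w : Word n) : pairMap id w = w := by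
  rcases w with _ | ⟨a, _ | ⟨b, w⟩⟩ <;> rfl

/-- Permutations of the words of length two, as permutations of `n^*`. -/
def pairPerm : Equiv.Perm (Fin n × Fin n) →* Equiv.Perm (Word n) where
  toFun p :=
    { toFun := pairMap p
      invFun := pairMap p.symm
      left_inv := fun w => by rw [← pairMap_comp, p.symm_comp_self, pairMap_id]
      right_inv := fun w => by rw [← pairMap_comp, p.self_comp_symm, pairMap_id] }
  map_one' := Equiv.ext pairMap_id
  map_mul' p q := Equiv.ext (pairMap_comp p q)

/-- Permutations of the words of length two, as elements of `V_n`. -/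
def pairGerm : Equiv.Perm (Fin n × Fin n) →* CofiniteGerm (Word n) := permGerm.comp pairPerm

theorem mapsCone_pairGerm (p : Equiv.Perm (Fin n × Fin n)) (x : Fin n × Fin n) :
    MapsCone (pairGerm p) [(p x).1, (p x).2] [x.1, x.2] :=
  mapsCone_permGerm fun _ _ => rfl

theorem pairGerm_mem_V (p : Equiv.Perm (Fin n × Fin n)) : pairGerm p ∈ V n := by
  refine permGerm_mem_V 2 fun w γ hw => ?_
  rcases w with _ | ⟨a, _ | ⟨b, w⟩⟩
  · simp at hw
  · simp at hw
  · rfl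

theorem pairGerm_injective [NeZero n] : Function.Injective (pairGerm (n := n)) := by
  rw [injective_iff_map_eq_one]
  intro p hp
  ext1 x
  have h := mapsCone_pairGerm p x
  rw [hp] at h
  have := (MapsCone.one _).unique h
  simp only [List.cons.injEq, and_true] at this
  exact Prod.ext this.1 this.2

theorem incomparable_cons_cons {a b : Fin n} (h : a ≠ b) (v w : Word n) :
    Incomparable (a :: v) (b :: w) :=
  ⟨fun h' => h (List.cons_prefix_cons.1 h').1, fun h' => h (List.cons_prefix_cons.1 h').1.symm⟩

theorem incomparable_cons_iff {a : Fin n} {v w : Word n} :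
    Incomparable (a :: v) (a :: w) ↔ Incomparable v w := by
  simp [Incomparable]

theorem pairGerm_swap {a b c d : Fin n} (h : Incomparable [a, b] [c, d]) :
    pairGerm (Equiv.swap (a, b) (c, d)) = coneSwap h := by
  refine eq_coneSwap h 2 ?_ ?_ fun w hw h1 h2 => ?_
  · simpa using mapsCone_pairGerm (Equiv.swap (a, b) (c, d)) (c, d)
  · simpa using mapsCone_pairGerm (Equiv.swap (a, b) (c, d)) (a, b)
  · obtain ⟨x, y, w, rfl⟩ : ∃ x y w', w = x :: y :: w' := by
      rcases w with _ | ⟨x, _ | ⟨y, w⟩⟩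
      · simp at hw
      · simp at hw
      · exact ⟨x, y, w, rfl⟩
    have h := (mapsCone_pairGerm (Equiv.swap (a, b) (c, d)) (x, y)).append w
    rwa [Equiv.swap_apply_of_ne_of_ne] at h
    · rintro ⟨⟩
      exact h1.1 (by simp)
    · rintro ⟨⟩
      exact h2.1 (by simp)

theorem mapsCone_pairGerm_prodCongr (q : Equiv.Perm (Fin n)) (a : Fin n) :
    MapsCone (pairGerm (q.prodCongr 1)) [q a] [a] :=
  .of_children fun i => mapsCone_pairGerm (q.prodCongr 1) (a, i)

theorem pairGerm_prodCongr_swap {a b : Fin n} (h : Incomparable [a] [b]) :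
    pairGerm ((Equiv.swap a b).prodCongr 1) = coneSwap h := by
  refine eq_coneSwap h 1 ?_ ?_ fun w hw h1 h2 => ?_
  · simpa using mapsCone_pairGerm_prodCongr (Equiv.swap a b) b
  · simpa using mapsCone_pairGerm_prodCongr (Equiv.swap a b) a
  · obtain ⟨x, w, rfl⟩ : ∃ x w', w = x :: w' := by
      rcases w with _ | ⟨x, w⟩
      · simp at hw
      · exact ⟨x, w, rfl⟩
    have h := (mapsCone_pairGerm_prodCongr (Equiv.swap a b) x).append w
    rwa [Equiv.swap_apply_of_ne_of_ne] at h
    · rintro rfl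
      exact h1.1 (by simp)
    · rintro rfl
      exact h2.1 (by simp)

/-! ### Generating all cone swaps -/

section

variable [NeZero n] {G : Subgroup (CofiniteGerm (Word n))}

theorem coneSwap_mem_iff_of_mapsCone (hGV : G ≤ V n) {g : CofiniteGerm (Word n)} (hg : g ∈ G)
    {α β α' β' : Word n} (h : Incomparable α β) (h' : Incomparable α' β')
    (h1 : MapsCone g α α') (h2 : MapsCone g β β') : coneSwap h ∈ G ↔ coneSwap h' ∈ G := by
  rw [← conj_coneSwap h (hGV hg) h1 h2 h', Subgroup.mul_mem_cancel_right G hg,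
    Subgroup.mul_mem_cancel_left G (inv_mem hg)]

theorem coneSwap_one_two_mem (hGV : G ≤ V n) (hpair : ∀ p, pairGerm p ∈ G) {i j k : Fin n}
    {h₀ : Incomparable [i] [j, k]} (h₀G : coneSwap h₀ ∈ G) {a b c : Fin n}
    (h : Incomparable [a] [b, c]) : coneSwap h ∈ G := by
  have hij : j ≠ i := by
    rintro rfl
    exact h₀.1 (by simp)
  have hab : a ≠ b := by
    rintro rfl
    exact h.1 (by simp)
  -- Move `i` to `a` by permuting the first letters, then move the other word with `[a]` fixed.
  obtain ⟨q, rfl⟩ : ∃ q : Equiv.Perm (Fin n), q a = i := ⟨_, Equiv.swap_apply_left a i⟩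
  obtain ⟨j, rfl⟩ := q.surjective j
  have haj : a ≠ j := fun h => hij (h ▸ rfl)
  have h₁ : Incomparable [a] [j, k] := incomparable_cons_cons haj _ _
  have h₁G : coneSwap h₁ ∈ G := (coneSwap_mem_iff_of_mapsCone hGV (hpair (q.prodCongr 1)) h₀ h₁
    (mapsCone_pairGerm_prodCongr q a) (mapsCone_pairGerm (q.prodCongr 1) (j, k))).1 h₀G
  refine (coneSwap_mem_iff_of_mapsCone hGV (hpair (Equiv.swap (j, k) (b, c))) h₁ h
    (.of_children fun x => ?_) ?_).1 h₁G
  · have := mapsCone_pairGerm (Equiv.swap (j, k) (b, c)) (a, x)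
    rwa [Equiv.swap_apply_of_ne_of_ne (by simp [haj]) (by simp [hab])] at this
  · simpa using mapsCone_pairGerm (Equiv.swap (j, k) (b, c)) (b, c)

theorem coneSwap_mem_of_length_le_two (hGV : G ≤ V n) (hpair : ∀ p, pairGerm p ∈ G)
    {i j k : Fin n} {h₀ : Incomparable [i] [j, k]} (h₀G : coneSwap h₀ ∈ G) {α β : Word n}
    (h : Incomparable α β) (hα : α.length ≤ 2) (hβ : β.length ≤ 2) : coneSwap h ∈ G := by
  rcases α with _ | ⟨a, _ | ⟨b, _ | ⟨x, α⟩⟩⟩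
  · exact absurd List.nil_prefix h.1
  · rcases β with _ | ⟨c, _ | ⟨d, _ | ⟨y, β⟩⟩⟩
    · exact absurd List.nil_prefix h.2
    · exact pairGerm_prodCongr_swap h ▸ hpair _
    · exact coneSwap_one_two_mem hGV hpair h₀G h
    · simp at hβ
  · rcases β with _ | ⟨c, _ | ⟨d, _ | ⟨y, β⟩⟩⟩
    · exact absurd List.nil_prefix h.2
    · exact coneSwap_symm h ▸ coneSwap_one_two_mem hGV hpair h₀G h.symm
    · exact pairGerm_swap h ▸ hpair _
    · simp at hβ
  · simp at hα

/-- If `α` and `β` begin with the same letter `a`, interchanging a cone `[a, b]` with a cone `[c]`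
outside `[a]` shortens `α` and does not lengthen `β`. -/
theorem coneSwap_mem_of_head_eq (hn : 2 ≤ n) (hGV : G ≤ V n)
    (hbase : ∀ {a b c : Fin n} (h : Incomparable [a, b] [c]), coneSwap h ∈ G)
    {a b : Fin n} {α β : Word n} (h : Incomparable (a :: b :: α) (a :: β))
    (ih : ∀ {α' β' : Word n} (h' : Incomparable α' β'), α'.length < (a :: b :: α).length →
      β'.length ≤ (a :: β).length → coneSwap h' ∈ G) : coneSwap h ∈ G := by
  have : Nontrivial (Fin n) := Fin.nontrivial_iff_two_le.2 hn
  obtain ⟨c, hc⟩ := exists_ne a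
  have hs : Incomparable [a, b] [c] := incomparable_cons_cons hc.symm _ _
  have hα : MapsCone (coneSwap hs) (a :: b :: α) (c :: α) := (mapsCone_coneSwap_left hs).append α
  by_cases hβ : [a, b] <+: a :: β
  · obtain ⟨β, hβ⟩ := hβ
    obtain rfl := List.cons_injective hβ
    have hβ : MapsCone (coneSwap hs) (a :: b :: β) (c :: β) :=
      (mapsCone_coneSwap_left hs).append β
    exact (coneSwap_mem_iff_of_mapsCone hGV (hbase hs) h (hα.incomparable hβ h) hα hβ).2
      (ih _ (by simp) (by simp))
  · have hβ : MapsCone (coneSwap hs) (a :: β) (a :: β) :=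
      mapsCone_coneSwap_of_incomparable hs
        ⟨hβ, fun h' => h.2 (h'.trans (List.prefix_append [a, b] α))⟩
        (incomparable_cons_cons hc _ _)
    exact (coneSwap_mem_iff_of_mapsCone hGV (hbase hs) h (hα.incomparable hβ h) hα hβ).2
      (ih _ (by simp) le_rfl)

/-- Conjugation by cone swaps of words of length at most two reduces every cone swap to
those. The sum of the powers of two measures the progress, since exchanging `[a, b] ++ α` and `[c]`
for `c :: α` and `[a, b]` leaves the sum of the lengths unchanged. -/
theorem coneSwap_mem (hn : 2 ≤ n) (hGV : G ≤ V n)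
    (hbase : ∀ {α β : Word n} (h : Incomparable α β), α.length ≤ 2 → β.length ≤ 2 →
      coneSwap h ∈ G) {α β : Word n} (h : Incomparable α β) : coneSwap h ∈ G := by
  have : Nontrivial (Fin n) := Fin.nontrivial_iff_two_le.2 hn
  induction hk : 2 ^ α.length + 2 ^ β.length using Nat.strong_induction_on generalizing α β with
  | _ k ih =>
  wlog hle : β.length ≤ α.length generalizing α β
  · exact coneSwap_symm h ▸ this h.symm (by omega) (by omega)
  have ih' : ∀ {α' β' : Word n} (h' : Incomparable α' β'), α'.length < α.length →
      β'.length ≤ β.length → coneSwap h' ∈ G := fun h' h1 h2 =>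
    ih _ (hk ▸ add_lt_add_of_lt_of_le (Nat.pow_lt_pow_right (by simp) h1)
      (Nat.pow_le_pow_right (by simp) h2)) h' rfl
  by_cases h2 : α.length ≤ 2
  · exact hbase h h2 (hle.trans h2)
  obtain ⟨a, b, x, α, rfl⟩ : ∃ a b x α', α = a :: b :: x :: α' := by
    rcases α with _ | ⟨a, _ | ⟨b, _ | ⟨x, α⟩⟩⟩
    · simp at h2
    · simp at h2
    · simp at h2
    · exact ⟨a, b, x, α, rfl⟩
  rcases β with _ | ⟨c, β⟩
  · exact absurd List.nil_prefix h.2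
  have hbase' : ∀ {a b c : Fin n} (h : Incomparable [a, b] [c]), coneSwap h ∈ G :=
    fun h => hbase h (by simp) (by simp)
  by_cases hac : a = c
  · subst hac
    exact coneSwap_mem_of_head_eq hn hGV hbase' h ih'
  rcases β with _ | ⟨d, β⟩
  · have hs : Incomparable [a, b] [c] := incomparable_cons_cons hac _ _
    have hα : MapsCone (coneSwap hs) (a :: b :: x :: α) (c :: x :: α) :=
      (mapsCone_coneSwap_left hs).append (x :: α)
    refine (coneSwap_mem_iff_of_mapsCone hGV (hbase' hs) h
      (incomparable_cons_cons (Ne.symm hac) _ _) hα (mapsCone_coneSwap_right hs)).2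
      (ih _ ?_ _ rfl)
    have := Nat.one_le_two_pow (n := α.length)
    simp only [List.length_cons, List.length_nil, pow_succ] at hk ⊢
    omega
  · -- Move `β` below `a` without changing its length or `α`.
    obtain ⟨e, he⟩ := exists_ne b
    have hs : Incomparable [a, e] [c, d] := incomparable_cons_cons hac _ _
    have hα : MapsCone (coneSwap hs) (a :: b :: x :: α) (a :: b :: x :: α) :=
      mapsCone_coneSwap_of_incomparable hs
        (incomparable_cons_iff.2 (incomparable_cons_cons he _ _))
        (incomparable_cons_cons (Ne.symm hac) _ _)
    have hβ : MapsCone (coneSwap hs) (c :: d :: β) (a :: e :: β) :=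
      (mapsCone_coneSwap_right hs).append β
    have h' := hα.incomparable hβ h
    exact (coneSwap_mem_iff_of_mapsCone hGV (hbase hs (by simp) (by simp)) h h' hα hβ).2
      (coneSwap_mem_of_head_eq hn hGV hbase' h' ih')

end

/-! ### Symmetric groups -/

/-- The product of the reflections `x ↦ -x` and `x ↦ 1 - x` is the cycle `x ↦ x + 1`, which
generates all permutations together with the transposition of two neighbours. -/
theorem closure_reflections_swap {m : ℕ} (hm : 2 ≤ m) :
    Subgroup.closure {Equiv.neg (ZMod m), Equiv.subLeft 1, Equiv.swap 0 1} = ⊤ := by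
  have : NeZero m := ⟨by omega⟩
  have : Fact (1 < m) := ⟨hm⟩
  let σ : Equiv.Perm (ZMod m) := Equiv.subLeft 1 * Equiv.neg (ZMod m)
  have hσ : ∀ x, σ x = x + 1 := fun x => by
    change 1 - -x = x + 1
    ring
  have hpow : ∀ k : ℕ, (σ ^ k) 0 = k := fun k => by
    induction k with
    | zero => simp
    | succ k ih => rw [pow_succ', Equiv.Perm.mul_apply, ih, hσ, Nat.cast_succ]
  have hcycle : σ.IsCycle := ⟨0, by simp [hσ], fun y _ => ⟨y.val, by
    rw [zpow_natCast, hpow, ZMod.natCast_zmod_val]⟩⟩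
  have hsupp : σ.support = Finset.univ := by
    ext x
    simp [hσ]
  rw [eq_top_iff, ← Equiv.Perm.closure_cycle_adjacent_swap hcycle hsupp 0, hσ, zero_add,
    Subgroup.closure_le, Set.pair_subset_iff]
  exact ⟨mul_mem (Subgroup.subset_closure (by simp)) (Subgroup.subset_closure (by simp)),
    Subgroup.subset_closure (by simp)⟩

/-! ### Four involutions -/

/-- The swap of a letter and a word of length two sends a word of length two to one of length
three, which no permutation of the words of length two does. -/
theorem coneSwap_one_two_ne_pairGerm [NeZero n] {i j k : Fin n} (h : Incomparable [i] [j, k])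
    (p : Equiv.Perm (Fin n × Fin n)) : pairGerm p ≠ coneSwap h := by
  intro hp
  obtain ⟨x, hx⟩ := p.surjective (i, k)
  have h1 := mapsCone_pairGerm p x
  rw [hx, hp] at h1
  simpa using congrArg List.length (h1.unique ((mapsCone_coneSwap_left h).append [k]))

/-- A numbering of the words of length two by `ZMod (n * n)`. Any numbering will do. -/
noncomputable def zmodEquivPair (n : ℕ) [NeZero n] : ZMod (n * n) ≃ Fin n × Fin n :=
  Fintype.equivOfCardEq (by simp [ZMod.card])

/-- Permutations of `ZMod (n * n)`, acting on the words of length two through `zmodEquivPair`, as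
elements of `V_n`. -/
noncomputable def zmodGerm (n : ℕ) [NeZero n] :
    Equiv.Perm (ZMod (n * n)) →* CofiniteGerm (Word n) :=
  pairGerm.comp (zmodEquivPair n).permCongrHom.toMonoidHom

theorem zmodGerm_injective [NeZero n] : Function.Injective (zmodGerm n) :=
  pairGerm_injective.comp (MulEquiv.injective _)

theorem exists_four_involutions (hn : 2 ≤ n) :
    ∃ s : Fin 4 → CofiniteGerm (Word n), Function.Injective s ∧ (∀ i, orderOf (s i) = 2) ∧
      Subgroup.closure (Set.range s) = V n := by
  have : NeZero n := ⟨by omega⟩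
  have h4 : 4 ≤ n * n := Nat.mul_le_mul hn hn
  have : Fact (1 < n * n) := ⟨by omega⟩
  have h₀ : Incomparable ([⟨0, by omega⟩] : Word n) [⟨1, by omega⟩, ⟨0, by omega⟩] :=
    incomparable_cons_cons (by simp) _ _
  have hnat : ∀ k : ℕ, k ≠ 0 → k < 4 → (k : ZMod (n * n)) ≠ 0 := fun k h0 hk h =>
    absurd (Nat.le_of_dvd (by omega) ((ZMod.natCast_eq_zero_iff _ _).1 h)) (by omega)
  have h2 : (2 : ZMod (n * n)) ≠ 0 := by exact_mod_cast hnat 2 (by omega) (by omega)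
  have h3 : (3 : ZMod (n * n)) ≠ 0 := by exact_mod_cast hnat 3 (by omega) (by omega)
  -- The three permutations are told apart by their values at `0` and `2`, since `2` and `3` are
  -- not divisible by `n²`.
  have n12 : Equiv.neg (ZMod (n * n)) ≠ Equiv.subLeft 1 := fun h => by
    simpa using Equiv.congr_fun h 0
  have n13 : Equiv.neg (ZMod (n * n)) ≠ Equiv.swap 0 1 := fun h => by
    simpa using Equiv.congr_fun h 0
  have n23 : Equiv.subLeft (1 : ZMod (n * n)) ≠ Equiv.swap 0 1 := fun h => by
    have h := Equiv.congr_fun h 2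
    rw [Equiv.swap_apply_of_ne_of_ne h2 (fun h => one_ne_zero (by linear_combination h))] at h
    change (1 : ZMod (n * n)) - 2 = 2 at h
    exact h3 (by linear_combination -h)
  let φ := zmodGerm n
  have horder : ∀ p, p * p = 1 → p ≠ 1 → orderOf (φ p) = 2 := fun p h1 h2 => by
    rw [orderOf_injective φ zmodGerm_injective]
    exact orderOf_eq_prime (by rw [sq, h1]) h2
  have hφ : ∀ p, φ p ≠ coneSwap h₀ := fun p => coneSwap_one_two_ne_pairGerm h₀ _
  let s : Fin 4 → CofiniteGerm (Word n) :=
    ![φ (Equiv.neg _), φ (Equiv.subLeft 1), φ (Equiv.swap 0 1), coneSwap h₀]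
  have hGV : Subgroup.closure (Set.range s) ≤ V n := by
    rw [Subgroup.closure_le]
    rintro _ ⟨i, rfl⟩
    fin_cases i
    · exact pairGerm_mem_V _
    · exact pairGerm_mem_V _
    · exact pairGerm_mem_V _
    · exact coneSwap_mem_V h₀
  refine ⟨s, ?_, ?_, le_antisymm hGV ?_⟩
  · have hnodup : [φ (Equiv.neg _), φ (Equiv.subLeft 1), φ (Equiv.swap 0 1),
        coneSwap h₀].Nodup := by
      simp only [List.nodup_cons, List.mem_cons, List.not_mem_nil, or_false, not_or,
        not_false_eq_true, List.nodup_nil, and_true]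
      exact ⟨⟨zmodGerm_injective.ne n12, zmodGerm_injective.ne n13, hφ _⟩,
        ⟨zmodGerm_injective.ne n23, hφ _⟩, hφ _⟩
    exact List.nodup_ofFn.1 hnodup
  · intro i
    fin_cases i
    · refine horder _ (Equiv.ext neg_neg) fun h => h2 ?_
      have h : (-1 : ZMod (n * n)) = 1 := Equiv.congr_fun h 1
      linear_combination -h
    · refine horder _ (Equiv.ext (sub_sub_cancel 1)) fun h => ?_
      simpa using Equiv.congr_fun h 0
    · exact horder _ (Equiv.swap_mul_self _ _) fun h => by simpa using Equiv.congr_fun h 0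
    · refine orderOf_eq_prime ((sq _).trans (coneSwap_mul_self h₀)) fun h => hφ 1 ?_
      rw [map_one]
      exact h.symm
  · have hmap : φ.range ≤ Subgroup.closure (Set.range s) := by
      rw [MonoidHom.range_eq_map, ← closure_reflections_swap (by omega), MonoidHom.map_closure,
        Subgroup.closure_le]
      rintro _ ⟨p, rfl | rfl | rfl, rfl⟩
      · exact Subgroup.subset_closure ⟨0, rfl⟩
      · exact Subgroup.subset_closure ⟨1, rfl⟩
      · exact Subgroup.subset_closure ⟨2, rfl⟩
    have hpair : ∀ p, pairGerm p ∈ Subgroup.closure (Set.range s) := fun p => by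
      obtain ⟨q, rfl⟩ := (zmodEquivPair n).permCongrHom.surjective p
      exact hmap ⟨q, rfl⟩
    have h₀G : coneSwap h₀ ∈ Subgroup.closure (Set.range s) :=
      Subgroup.subset_closure ⟨3, rfl⟩
    exact V_le_of_coneSwap_mem hn hGV fun h => coneSwap_mem hn hGV
      (fun h => coneSwap_mem_of_length_le_two hGV hpair h₀G h) h

end HigmanThompson

theorem mainTheorem4 (n : ℕ) (hn : 2 ≤ n) :
    ∃ s : Fin 4 → HigmanThompson.V n, Function.Injective s ∧ (∀ i, orderOf (s i) = 2) ∧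
      Subgroup.closure (Set.range s) = ⊤ := by
  obtain ⟨s, hinj, hord, hclosure⟩ := HigmanThompson.exists_four_involutions hn
  have hs : ∀ i, s i ∈ HigmanThompson.V n := fun i =>
    hclosure ▸ Subgroup.subset_closure (Set.mem_range_self i)
  refine ⟨fun i => ⟨s i, hs i⟩, fun i j h => hinj (Subtype.ext_iff.1 h),
    fun i => by rw [Subgroup.orderOf_mk, hord], ?_⟩
  apply Subgroup.map_injective (HigmanThompson.V n).subtype_injective
  rw [MonoidHom.map_closure, ← Set.range_comp, ← MonoidHom.range_eq_map, Subgroup.range_subtype]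
  exact hclosure
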